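/- Let $\Bbbk$ be a field, let $P = \Bbbk[x_1, \ldots, x_n]$ with the standard grading, and for a homogeneous ideal $I \subseteq P$ let $H(I,d) = \dim_{\Bbbk} I_d$ be its Hilbert function, where $I_d$ is the degree $d$ homogeneous component of $I$. An ideal is generated in degree $d$ if it is generated by homogeneous polynomials of degree $d$ (the zero ideal is allowed). A homogeneous ideal $I \subseteq P$ generated in degree $d$ is called Gotzmann if $H(I,d+1) \leq H(J,d+1)$ for all homogeneous ideals $J \subseteq P$ with $H(J,d) = H(I,d)$. Let $I \subseteq P$ be a homogeneous ideal generated in degree two and let $m = H(I,2)$. If $m \leq n$, then $I$ is Gotzmann (with $d = 2$ in the definition) if and only if \[ H(I,3) = mn + \frac{1}{2}m - \frac{1}{2}m^2. \] -/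

import Mathlib

open MvPolynomial

attribute [local instance] MvPolynomial.gradedAlgebra

/-- The degree `d` component `I_d = I ∩ P_d` of an ideal `I` of `P = 𝕜[x₁, …, xₙ]`, where `P` has
the standard grading, as a `𝕜`-linear subspace of `P`. -/
noncomputable def idealComponent {𝕜 : Type*} [Field 𝕜] {n : ℕ} (I : Ideal (MvPolynomial (Fin n) 𝕜)) (d : ℕ) :
    Submodule 𝕜 (MvPolynomial (Fin n) 𝕜) :=
  I.restrictScalars 𝕜 ⊓ homogeneousSubmodule (Fin n) 𝕜 d

/-- The components are finite dimensional, so that `Module.finrank` below is the true dimension. -/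
theorem finiteDimensional_idealComponent {𝕜 : Type*} [Field 𝕜] {n : ℕ}
    (I : Ideal (MvPolynomial (Fin n) 𝕜)) (d : ℕ) :
    FiniteDimensional 𝕜 (idealComponent I d) := by
  refine Submodule.finiteDimensional_of_le (S₂ := restrictTotalDegree (Fin n) 𝕜 d) ?_
  rintro p ⟨-, hp⟩
  rw [mem_restrictTotalDegree]
  exact IsHomogeneous.totalDegree_le hp

/-- The Hilbert function `H(I, d) = dim_𝕜 I_d`. -/
noncomputable def hilbertFunction {𝕜 : Type*} [Field 𝕜] {n : ℕ}
    (I : Ideal (MvPolynomial (Fin n) 𝕜)) (d : ℕ) : ℕ :=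
  Module.finrank 𝕜 (idealComponent I d)

/-- `I` is generated in degree `d`: it is generated by a set of homogeneous polynomials of
degree `d`. -/
def GeneratedInDegree {𝕜 : Type*} [Field 𝕜] {n : ℕ}
    (I : Ideal (MvPolynomial (Fin n) 𝕜)) (d : ℕ) : Prop :=
  ∃ S : Set (MvPolynomial (Fin n) 𝕜), (∀ f ∈ S, f.IsHomogeneous d) ∧ I = Ideal.span S

/-- `I` is a `d`-Gotzmann ideal: a homogeneous ideal generated in degree `d` such that
`H(I, d + 1) ≤ H(J, d + 1)` for all homogeneous ideals `J` with `H(I, d) = H(J, d)`. -/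
def IsGotzmann {𝕜 : Type*} [Field 𝕜] {n : ℕ}
    (I : Ideal (MvPolynomial (Fin n) 𝕜)) (d : ℕ) : Prop :=
  I.IsHomogeneous (homogeneousSubmodule (Fin n) 𝕜) ∧ GeneratedInDegree I d ∧
    ∀ J : Ideal (MvPolynomial (Fin n) 𝕜), J.IsHomogeneous (homogeneousSubmodule (Fin n) 𝕜) →
      hilbertFunction I d = hilbertFunction J d →
      hilbertFunction I (d + 1) ≤ hilbertFunction J (d + 1)

/-! The right-hand side is `m * n - m.choose 2`, and the point is that this is the least value of
`H(J, 3)` when `H(J, 2) = m ≤ n`. For the lower bound, replace `J_2` by its `m` leading exponents: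
their multiples by variables are leading exponents of `J_3`. Two distinct monomials share at most
one such multiple, so each new monomial loses at most one of its `n` multiples to each earlier one,
for a total loss of at most `m.choose 2`. The bound is attained by `(x₀x₀, …, x₀xₘ₋₁)`, which exists
because `m ≤ n`. -/

section MonomialCounting

/-- Distinct vectors `s ≠ u` have at most one common upper neighbour of the form
`u + single i 1 = s + single j 1`. -/
theorem Finsupp.eq_of_add_single_eq_add_single {σ : Type*} {s u : σ →₀ ℕ} (hsu : s ≠ u)
    {i j i' j' : σ} (h : u + single i 1 = s + single j 1)
    (h' : u + single i' 1 = s + single j' 1) : i = i' := by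
  classical
  by_contra hne
  have hij : i ≠ j := by
    rintro rfl
    exact hsu (add_right_cancel h).symm
  -- At coordinate `i`, `h` gives `u i + 1 = s i`, while `h'` gives `s i ≤ u i`.
  have h1 := DFunLike.congr_fun h i
  have h2 := DFunLike.congr_fun h' i
  simp only [Finsupp.add_apply, Finsupp.single_apply, if_true, if_neg hij.symm,
    if_neg (Ne.symm hne)] at h1 h2
  omega

open Finset Pointwise in
/-- Macaulay's growth bound for monomials: `k` monomials have at least `k * n - k.choose 2`
multiples by one of the `n` variables. -/
theorem Finsupp.card_mul_card_le_card_add_single {σ : Type*} [Fintype σ] [DecidableEq σ]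
    (S : Finset (σ →₀ ℕ)) :
    #S * Fintype.card σ ≤ #(S + univ.image fun i : σ => single i 1) + (#S).choose 2 := by
  set U : Finset (σ →₀ ℕ) := univ.image fun i : σ => single i 1
  have hU : #U = Fintype.card σ :=
    card_image_of_injective _ (Finsupp.single_left_injective one_ne_zero)
  induction S using Finset.induction_on with
  | empty => simp
  | insert u S hu ih =>
    have hone : ∀ s ∈ S, #(({u} + U) ∩ ({s} + U)) ≤ 1 := by
      intro s hs
      refine Finset.card_le_one.mpr fun a ha b hb => ?_
      simp only [U, mem_inter, mem_add, mem_singleton, mem_image, mem_univ, true_and,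
        exists_eq_left, exists_exists_eq_and] at ha hb
      obtain ⟨⟨i, rfl⟩, j, hj⟩ := ha
      obtain ⟨⟨i', rfl⟩, j', hj'⟩ := hb
      rw [Finsupp.eq_of_add_single_eq_add_single (ne_of_mem_of_not_mem hs hu) hj.symm hj'.symm]
    have hinter : #(({u} + U) ∩ (S + U)) ≤ #S := by
      have hsub : ({u} + U) ∩ (S + U) ⊆ S.biUnion fun s => ({u} + U) ∩ ({s} + U) := by
        intro a ha
        obtain ⟨ha, ha'⟩ := mem_inter.mp ha
        obtain ⟨s, hs, v, hv, rfl⟩ := mem_add.mp ha'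
        exact mem_biUnion.mpr ⟨s, hs, mem_inter.mpr
          ⟨ha, add_mem_add (mem_singleton_self s) hv⟩⟩
      simpa using (card_le_card hsub).trans (card_biUnion_le_card_mul _ _ 1 hone)
    have hunion : insert u S + U = ({u} + U) ∪ (S + U) := by
      rw [insert_eq, union_add]
    have hcard := card_union_add_card_inter ({u} + U) (S + U)
    rw [← hunion, card_singleton_add, hU] at hcard
    -- By Pascal's rule the allowed loss grows by exactly `#S`, the bound in `hinter`.
    rw [card_insert_of_notMem hu, Nat.choose_succ_succ' _ 1, Nat.choose_one_right]
    linarith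

end MonomialCounting

namespace MonomialOrder

open MvPolynomial

variable {σ K : Type*} [Field K] (mo : MonomialOrder σ)

/-- Nonzero polynomials with pairwise distinct leading exponents are linearly independent. -/
theorem linearIndependent_of_degree_eq {T : Set (σ →₀ ℕ)} (f : T → MvPolynomial σ K)
    (hf : ∀ t, f t ≠ 0) (hdeg : ∀ t, mo.degree (f t) = t) : LinearIndependent K f := by
  classical
  rw [linearIndependent_iff']
  intro s g hg
  by_contra! hne
  obtain ⟨i₀, hi₀, hgi₀⟩ := hne
  -- At the largest leading exponent in the relation, no other term contributes.
  obtain ⟨t, ht, hmax⟩ := (s.filter fun i => g i ≠ 0).exists_max_image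
    (fun i => mo.toSyn (i : σ →₀ ℕ)) ⟨i₀, by simp [hi₀, hgi₀]⟩
  rw [Finset.mem_filter] at ht
  have hcoeff := congrArg (coeff (t : σ →₀ ℕ)) hg
  rw [coeff_sum, Finset.sum_eq_single t, coeff_smul, coeff_zero, smul_eq_zero] at hcoeff
  · refine hcoeff.elim ht.2 fun h => ?_
    nth_rewrite 1 [← hdeg t] at h
    exact mo.coeff_degree_ne_zero_iff.mpr (hf t) h
  · intro i hi hit
    by_cases hgi : g i = 0
    · simp [hgi]
    rw [coeff_smul, mo.coeff_eq_zero_of_lt, smul_zero]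
    rw [hdeg]
    refine lt_of_le_of_ne (hmax i (by simp [hi, hgi])) fun h => hit ?_
    exact Subtype.ext (mo.toSyn.injective h)
  · exact fun h => absurd ht.1 h

/-- The number of leading exponents of a finite dimensional space of polynomials is at most its
dimension. -/
theorem card_le_finrank_of_forall_exists_degree_eq (W : Submodule K (MvPolynomial σ K))
    [FiniteDimensional K W] (T : Finset (σ →₀ ℕ))
    (h : ∀ t ∈ T, ∃ f ∈ W, f ≠ 0 ∧ mo.degree f = t) : T.card ≤ Module.finrank K W := by
  choose f hfW hf0 hdeg using h
  have hli : LinearIndependent K fun t : (T : Set (σ →₀ ℕ)) => f t t.2 :=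
    mo.linearIndependent_of_degree_eq _ (fun t => hf0 t t.2) (fun t => hdeg t t.2)
  have hli' : LinearIndependent K fun t : (T : Set (σ →₀ ℕ)) => (⟨f t t.2, hfW t t.2⟩ : W) :=
    LinearIndependent.of_comp W.subtype hli
  simpa using hli'.fintype_card_le_finrank

/-- A space of polynomials whose leading exponents lie in `T` has dimension at most `#T`. -/
theorem finrank_le_card_of_forall_degree_mem (W : Submodule K (MvPolynomial σ K))
    (T : Finset (σ →₀ ℕ)) (h : ∀ f ∈ W, f ≠ 0 → mo.degree f ∈ T) :
    Module.finrank K W ≤ T.card := by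
  -- Reading off the coefficients at `T` is injective: a nonzero `f` has a nonzero one at its own
  -- leading exponent.
  let φ : W →ₗ[K] (T → K) := LinearMap.pi fun t => (lcoeff K (t : σ →₀ ℕ)).comp W.subtype
  have hφ : Function.Injective φ := by
    rw [← LinearMap.ker_eq_bot, LinearMap.ker_eq_bot']
    rintro ⟨f, hf⟩ hzero
    by_contra hne
    have hf0 : f ≠ 0 := fun h0 => hne (Subtype.ext h0)
    have := congrFun hzero ⟨_, h f hf hf0⟩
    exact mo.coeff_degree_ne_zero_iff.mpr hf0 this
  simpa using LinearMap.finrank_le_finrank_of_injective hφ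

end MonomialOrder

section HilbertFunction

open MvPolynomial

variable {𝕜 : Type*} [Field 𝕜] {n : ℕ}

theorem mem_idealComponent {I : Ideal (MvPolynomial (Fin n) 𝕜)} {d : ℕ}
    {f : MvPolynomial (Fin n) 𝕜} : f ∈ idealComponent I d ↔ f ∈ I ∧ f.IsHomogeneous d :=
  Iff.rfl

theorem X_mul_mem_idealComponent_succ {I : Ideal (MvPolynomial (Fin n) 𝕜)} {d : ℕ}
    {f : MvPolynomial (Fin n) 𝕜} (hf : f ∈ idealComponent I d) (i : Fin n) :
    X i * f ∈ idealComponent I (d + 1) := by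
  rw [mem_idealComponent] at hf ⊢
  refine ⟨I.mul_mem_left _ hf.1, ?_⟩
  rw [add_comm]
  exact (isHomogeneous_X 𝕜 i).mul hf.2

open Pointwise in
/-- Macaulay's lower bound on the growth of the Hilbert function of an ideal, in the range where
the binomial expansion is explicit. -/
theorem hilbertFunction_mul_le_hilbertFunction_succ_add_choose
    (I : Ideal (MvPolynomial (Fin n) 𝕜)) (d : ℕ) :
    hilbertFunction I d * n ≤ hilbertFunction I (d + 1) + (hilbertFunction I d).choose 2 := by
  classical
  let mo : MonomialOrder (Fin n) := MonomialOrder.lex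
  have := finiteDimensional_idealComponent I d
  have := finiteDimensional_idealComponent I (d + 1)
  have hfin : {t | ∃ f ∈ idealComponent I d, f ≠ 0 ∧ mo.degree f = t}.Finite := by
    refine (Finsupp.finite_of_degree_le d).subset ?_
    rintro t ⟨f, hf, hf0, rfl⟩
    have hcoeff := mo.coeff_degree_ne_zero_iff.mpr hf0
    exact (not_imp_comm.mp (mem_idealComponent.mp hf).2.coeff_eq_zero hcoeff).le
  set T := hfin.toFinset
  have hT : T.card = hilbertFunction I d := by
    apply le_antisymm
    · exact mo.card_le_finrank_of_forall_exists_degree_eq _ T fun t ht => by simpa [T] using ht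
    · exact mo.finrank_le_card_of_forall_degree_mem _ T fun f hf hf0 => by
        simpa [T] using ⟨f, hf, hf0, rfl⟩
  have hsucc : (T + Finset.univ.image fun i : Fin n => Finsupp.single i 1).card ≤
      hilbertFunction I (d + 1) := by
    refine mo.card_le_finrank_of_forall_exists_degree_eq _ _ fun t ht => ?_
    obtain ⟨s, hs, v, hv, rfl⟩ := Finset.mem_add.mp ht
    obtain ⟨i, -, rfl⟩ := Finset.mem_image.mp hv
    obtain ⟨f, hf, hf0, rfl⟩ := hfin.mem_toFinset.mp hs
    refine ⟨X i * f, X_mul_mem_idealComponent_succ hf i, mul_ne_zero (X_ne_zero i) hf0, ?_⟩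
    rw [mo.degree_mul (X_ne_zero i) hf0, mo.degree_X, add_comm]
  have hcount := Finsupp.card_mul_card_le_card_add_single T
  rw [hT, Fintype.card_fin] at hcount
  exact hcount.trans (Nat.add_le_add_right hsucc _)

/-- The Hilbert function of a monomial ideal counts the monomials in it. -/
theorem hilbertFunction_span_monomial (S : Set (Fin n →₀ ℕ)) (d : ℕ) :
    hilbertFunction (Ideal.span ((fun s => monomial s (1 : 𝕜)) '' S)) d =
      {e : Fin n →₀ ℕ | e.degree = d ∧ ∃ s ∈ S, s ≤ e}.ncard := by
  have hcomp : idealComponent (Ideal.span ((fun s => monomial s (1 : 𝕜)) '' S)) d =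
      restrictSupport 𝕜 {e : Fin n →₀ ℕ | e.degree = d ∧ ∃ s ∈ S, s ≤ e} := by
    ext f
    rw [mem_idealComponent, mem_ideal_span_monomial_image, mem_restrictSupport_iff]
    constructor
    · rintro ⟨h, hd⟩ e he
      exact ⟨not_imp_comm.mp hd.coeff_eq_zero (mem_support_iff.mp he), h e he⟩
    · intro h
      refine ⟨fun e he => (h he).2, fun e he => ?_⟩
      exact (DFunLike.congr_fun Finsupp.degree_eq_weight_one e).symm.trans
        (h (mem_support_iff.mpr he)).1
  rw [hilbertFunction, hcomp, Module.finrank_eq_nat_card_basis (basisRestrictSupport 𝕜 _),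
    Nat.card_coe_set_eq]

/-- The exponent of the monomial `x₀ xᵢ`. -/
noncomputable def lexExponent {m : ℕ} (hmn : m ≤ n) (i : Fin m) : Fin n →₀ ℕ :=
  Finsupp.single ⟨0, i.pos.trans_le hmn⟩ 1 + Finsupp.single (i.castLE hmn) 1

theorem lexExponent_injective {m : ℕ} (hmn : m ≤ n) :
    Function.Injective (lexExponent hmn) := fun i j h => by
  have h' := Finsupp.single_left_injective one_ne_zero (add_left_cancel h)
  exact Fin.castLE_injective hmn h'

theorem degree_lexExponent {m : ℕ} (hmn : m ≤ n) (i : Fin m) :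
    (lexExponent hmn i).degree = 2 := by
  simp [lexExponent, map_add]

/-- The sum counts pairs `i ≤ j` with `i < m`, `j < n`, which index the cubics `x₀ xᵢ xⱼ`. -/
theorem sum_fin_sub_add_choose {m : ℕ} (hmn : m ≤ n) :
    ∑ i : Fin m, (n - (i : ℕ)) + m.choose 2 = m * n := by
  have hsum : m.choose 2 = ∑ i : Fin m, (i : ℕ) := by
    rw [Fin.sum_univ_eq_sum_range (fun i => i) m, Finset.sum_range_id, Nat.choose_two_right]
  rw [hsum, ← Finset.sum_add_distrib, Finset.sum_congr rfl fun i _ =>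
    Nat.sub_add_cancel (i.isLt.le.trans hmn)]
  simp

/-- The lexicographic segment ideal `(x₀ x₀, …, x₀ xₘ₋₁)`. -/
noncomputable def lexIdeal (𝕜 : Type*) [Field 𝕜] {m : ℕ} (hmn : m ≤ n) :
    Ideal (MvPolynomial (Fin n) 𝕜) :=
  Ideal.span ((fun s => monomial s (1 : 𝕜)) '' Set.range (lexExponent hmn))

theorem isHomogeneous_lexIdeal {m : ℕ} (hmn : m ≤ n) :
    (lexIdeal 𝕜 hmn).IsHomogeneous (homogeneousSubmodule (Fin n) 𝕜) := by
  refine Ideal.homogeneous_span _ _ ?_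
  rintro _ ⟨_, ⟨i, rfl⟩, rfl⟩
  exact ⟨2, isHomogeneous_monomial 1 (degree_lexExponent hmn i)⟩

theorem hilbertFunction_lexIdeal_two {m : ℕ} (hmn : m ≤ n) :
    hilbertFunction (lexIdeal 𝕜 hmn) 2 = m := by
  rw [lexIdeal, hilbertFunction_span_monomial]
  have hset : {e : Fin n →₀ ℕ | e.degree = 2 ∧ ∃ s ∈ Set.range (lexExponent hmn), s ≤ e} =
      Set.range (lexExponent hmn) := by
    ext e
    constructor
    · rintro ⟨he, _, ⟨i, rfl⟩, hle⟩
      obtain ⟨c, rfl⟩ := exists_add_of_le hle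
      rw [map_add, degree_lexExponent, Nat.add_eq_left, Finsupp.degree_eq_zero_iff] at he
      exact ⟨i, by rw [he, add_zero]⟩
    · rintro ⟨i, rfl⟩
      exact ⟨degree_lexExponent hmn i, _, ⟨i, rfl⟩, le_rfl⟩
  rw [hset, ← Set.image_univ, Set.ncard_image_of_injective _ (lexExponent_injective hmn),
    Set.ncard_univ, Nat.card_fin]

/-- Cubics in the ideal are `x₀ xᵢ xⱼ` with `i < m`, and symmetry in `i, j` lets one assume `i ≤ j`.
-/
theorem hilbertFunction_lexIdeal_three_add_choose_le {m : ℕ} (hmn : m ≤ n) :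
    hilbertFunction (lexIdeal 𝕜 hmn) 3 + m.choose 2 ≤ m * n := by
  classical
  let A : Finset (Fin m × Fin n) :=
    Finset.univ.biUnion fun i => (Finset.Ici (i.castLE hmn)).image fun j => (i, j)
  have hA : A.card ≤ ∑ i : Fin m, (n - (i : ℕ)) := by
    refine Finset.card_biUnion_le.trans (Finset.sum_le_sum fun i _ => ?_)
    refine Finset.card_image_le.trans ?_
    simp
  have hmem : ∀ i j, (i, j) ∈ A ↔ i.castLE hmn ≤ j := by simp [A]
  have hsub : {e : Fin n →₀ ℕ | e.degree = 3 ∧ ∃ s ∈ Set.range (lexExponent hmn), s ≤ e} ⊆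
      (A.image fun p => lexExponent hmn p.1 + Finsupp.single p.2 1 : Finset _) := by
    rintro e ⟨he, _, ⟨i, rfl⟩, hle⟩
    obtain ⟨c, rfl⟩ := exists_add_of_le hle
    rw [map_add, degree_lexExponent] at he
    obtain ⟨j, rfl⟩ : ∃ j, c = Finsupp.single j 1 :=
      (Finsupp.sum_eq_one_iff c).mp (Nat.add_left_cancel he)
    rw [Finset.mem_coe, Finset.mem_image]
    rcases le_total (i.castLE hmn) j with hij | hij
    · exact ⟨(i, j), (hmem i j).mpr hij, rfl⟩
    -- Here `j ≤ i < m`, so `x₀ xⱼ` is also a generator and the roles can be swapped.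
    · have hjm : (j : ℕ) < m := (Fin.le_def.mp hij).trans_lt i.isLt
      refine ⟨(⟨j, hjm⟩, i.castLE hmn), (hmem _ _).mpr hij, ?_⟩
      exact add_right_comm _ _ _
  rw [lexIdeal, hilbertFunction_span_monomial, ← sum_fin_sub_add_choose hmn]
  refine Nat.add_le_add_right ?_ _
  refine (Set.ncard_le_ncard hsub (Finset.finite_toSet _)).trans ?_
  rw [Set.ncard_coe_finset]
  exact Finset.card_image_le.trans hA

end HilbertFunction

theorem mainTheorem4 {𝕜 : Type*} [Field 𝕜] (n : ℕ) (I : Ideal (MvPolynomial (Fin n) 𝕜))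
    (hI : I.IsHomogeneous (MvPolynomial.homogeneousSubmodule (Fin n) 𝕜))
    (hgen : GeneratedInDegree I 2) (m : ℕ) (hm : m = hilbertFunction I 2) (hmn : m ≤ n) :
    IsGotzmann I 2 ↔
      (hilbertFunction I 3 : ℚ) = (m : ℚ) * n + (1 / 2) * m - (1 / 2) * (m : ℚ) ^ 2 := by
  have hlower : ∀ J : Ideal (MvPolynomial (Fin n) 𝕜), hilbertFunction J 2 = m →
      m * n ≤ hilbertFunction J 3 + m.choose 2 := fun J hJ => by
    simpa [hJ] using hilbertFunction_mul_le_hilbertFunction_succ_add_choose J 2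
  have hchoose : (m.choose 2 : ℚ) = m * (m - 1) / 2 := Nat.cast_choose_two ℚ m
  have hformula : (hilbertFunction I 3 : ℚ) = (m : ℚ) * n + (1 / 2) * m - (1 / 2) * (m : ℚ) ^ 2 ↔
      hilbertFunction I 3 + m.choose 2 = m * n := by
    rw [← @Nat.cast_inj ℚ]
    push_cast
    rw [hchoose]
    constructor <;> intro h <;> linarith
  rw [hformula]
  constructor
  · rintro ⟨-, -, hmin⟩
    -- Comparison with the extremal ideal forces equality in the lower bound.
    have h3 := hmin (lexIdeal 𝕜 hmn) (isHomogeneous_lexIdeal hmn)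
      (by rw [← hm, hilbertFunction_lexIdeal_two])
    exact le_antisymm
      ((Nat.add_le_add_right h3 _).trans (hilbertFunction_lexIdeal_three_add_choose_le hmn))
      (hlower I hm.symm)
  · intro h
    refine ⟨hI, hgen, fun J _ hJ => ?_⟩
    have := hlower J (hJ ▸ hm.symm)
    change hilbertFunction I 3 ≤ hilbertFunction J 3
    omega
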